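/- **Guarded METAs.** A guarded multi-energy timed automaton (guarded META) consists of finite sets of actions, of locations, of atomic propositions, of clocks $X$ and of energy variables $\mathcal E$; an initial location $\ell_0$; a nonempty set of private locations and a nonempty set of final locations, the two being disjoint; a labelling of the locations by sets of atomic propositions; for each location $\ell$ an invariant $I(\ell)$ and an energy rate $\phi(\ell):\mathcal E\to\mathbb Z$; and a finite set of edges $(\ell,g,a,R,U,\ell')$ with guard $g$, action $a$ (possibly silent), reset set $R\subseteq X$ and energy update $U:\mathcal E\to\mathbb Z$. Guards and invariants are finite conjunctions of inequalities $v\bowtie c$ with $v\in X\cup\mathcal E$, ${\bowtie}\in\{<,\le,\ge,>\}$, $c\in\mathbb Z$. Final locations have no outgoing edges, and the zero valuations satisfy $I(\ell_0)$. The automaton is *discrete* if all rates are $0$, so that energy variables change only along edges. **Runs.** A state is a triple $(\ell,w,v)$ of a location, a clock valuation $w\in\mathbb R_{\ge0}^X$ and an energy valuation $v\in\mathbb R_{\ge 0}^{\mathcal E}$ that together satisfy $I(\ell)$. A run starts in the state $(\ell_0,0,0)$ and is a finite sequence of $n\ge 0$ steps. The step number $i$ ($0\le i<n$) first lets a real time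 $d_i\ge0$ elapse (clocks grow at rate $1$, energies at the rates of the location, and one stays in the set of states throughout), and then takes an edge whose guard holds, resets the clocks in $R$ to $0$ and adds $U$ to the energy valuation; the result must again be a state. Let $v_0=0$, and let $v_{i+1}$ be the energy valuation after step $i$. A run is *private* if it ends in a final location and visits a private location; it is *public* if it ends in a final location and visits no private location. **Discrete energy observation.** For a run $\rho$ of a discrete guarded META and $t\ge 0$, let $\mathrm{EL}(\rho,t)=v_k$, where $k\le n$ is the largest number such that $\sum_{j<k}d_j\le t$. The observation of $\rho$ is the finite sequence $\mathrm{DEO}(\rho)=\big(\mathrm{EL}(\rho,1),\dots,\mathrm{EL}(\rho,K)\big)$ with $K=\big\lceil\sum_{j<n}d_j\big\rceil$. The automaton is *$\exists$-DE-opaque* if some private run and some public run have the same observation; *weakly DE-opaque* if for every private run there is a public run with the same observation; *fully DE-opaque* if it is weakly DE-opaque and for every public run there is a private run with the same observation. **Proposition.** For each $\delta\in\{\exists,\text{weak},\text{full}\}$, the following problem is undecidable: given a discrete guarded META with exactly two energy variables and one clock, is it $\delta$-DE-opaque? -/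

import Mathlib

/-! Guarded multi-energy timed automata (guarded METAs), their dense-time semantics, the
discrete-time observation of energy, and the associated opacity notions.

So that automata can be inputs of algorithms, the finite sets occurring in an automaton are initial
segments of the natural numbers: actions, atomic propositions and locations are numbers, clocks are
`Fin nX` and energy variables are `Fin nE`. -/

/-- The comparison operators `<`, `≤`, `≥`, `>`. -/
inductive Cmp where
  | lt | le | ge | gt

/-- Truth of `a ⋈ b`. -/
def Cmp.Holds : Cmp → ℝ → ℝ → Prop
  | .lt, a, b => a < b
  | .le, a, b => a ≤ b
  | .ge, a, b => b ≤ a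
  | .gt, a, b => b < a

/-- An inequality `v ⋈ c`, where `v` is a clock or an energy variable and `c` is an integer. -/
structure Atom (nX nE : ℕ) where
  var : Fin nX ⊕ Fin nE
  op : Cmp
  const : ℤ

/-- A simple constraint: a finite conjunction of inequalities. -/
abbrev SimpleConstraint (nX nE : ℕ) := List (Atom nX nE)

/-- The satisfaction relation of simple constraints, for a clock valuation `w` and an energy
valuation `v`. -/
def SimpleConstraint.Sat {nX nE : ℕ} (g : SimpleConstraint nX nE)
    (w : Fin nX → ℝ) (v : Fin nE → ℝ) : Prop :=
  ∀ a ∈ g, a.op.Holds (Sum.elim w v a.var) (a.const : ℝ)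

/-- The data attached to a location: whether it is private, whether it is final, its label (a
finite set of atomic propositions, given as a list), its invariant and its energy rates. -/
structure LocData (nX nE : ℕ) where
  isPriv : Bool
  isFinal : Bool
  label : List ℕ
  inv : SimpleConstraint nX nE
  rate : Fin nE → ℤ

/-- An edge: source, guard, action (`none` is the silent action), set of clocks to be reset (as a
characteristic function), energy update (offsets) and target. -/
structure Edge (nX nE : ℕ) where
  src : ℕ
  guard : SimpleConstraint nX nE
  act : Option ℕ
  reset : Fin nX → Bool
  update : Fin nE → ℤ
  tgt : ℕ

/-- The data of a guarded META with `nX` clocks and `nE` energy variables. The actions are the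
numbers below `numActions`, the atomic propositions those below `numProps`, and the locations are
the positions in the list `locs`. The requirements on these data are in
`GuardedMETA.WellFormed`. -/
structure GuardedMETA (nX nE : ℕ) where
  numActions : ℕ
  numProps : ℕ
  locs : List (LocData nX nE)
  init : ℕ
  edges : List (Edge nX nE)

section Encoding

/-- Comparison operators as the elements of `Fin 4`. -/
def Cmp.equivFin : Cmp ≃ Fin 4 where
  toFun
    | .lt => 0
    | .le => 1
    | .ge => 2
    | .gt => 3
  invFun
    | 0 => .lt
    | 1 => .le
    | 2 => .ge
    | 3 => .gt
  left_inv c := by cases c <;> rfl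
  right_inv i := by fin_cases i <;> rfl

instance : Primcodable Cmp := Primcodable.ofEquiv (Fin 4) Cmp.equivFin

/-- Atoms as tuples. -/
def Atom.equivProd (nX nE : ℕ) : Atom nX nE ≃ (Fin nX ⊕ Fin nE) × Cmp × ℤ where
  toFun a := (a.var, a.op, a.const)
  invFun p := ⟨p.1, p.2.1, p.2.2⟩
  left_inv _ := rfl
  right_inv _ := rfl

instance (nX nE : ℕ) : Primcodable (Atom nX nE) := Primcodable.ofEquiv _ (Atom.equivProd nX nE)

/-- Location data as tuples. -/
def LocData.equivProd (nX nE : ℕ) :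
    LocData nX nE ≃ Bool × Bool × List ℕ × List (Atom nX nE) × (Fin nE → ℤ) where
  toFun l := (l.isPriv, l.isFinal, l.label, l.inv, l.rate)
  invFun p := ⟨p.1, p.2.1, p.2.2.1, p.2.2.2.1, p.2.2.2.2⟩
  left_inv _ := rfl
  right_inv _ := rfl

instance (nX nE : ℕ) : Primcodable (LocData nX nE) :=
  Primcodable.ofEquiv _ (LocData.equivProd nX nE)

/-- Edges as tuples. -/
def Edge.equivProd (nX nE : ℕ) :
    Edge nX nE ≃ ℕ × List (Atom nX nE) × Option ℕ × (Fin nX → Bool) × (Fin nE → ℤ) × ℕ where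
  toFun e := (e.src, e.guard, e.act, e.reset, e.update, e.tgt)
  invFun p := ⟨p.1, p.2.1, p.2.2.1, p.2.2.2.1, p.2.2.2.2.1, p.2.2.2.2.2⟩
  left_inv _ := rfl
  right_inv _ := rfl

instance (nX nE : ℕ) : Primcodable (Edge nX nE) := Primcodable.ofEquiv _ (Edge.equivProd nX nE)

/-- Guarded METAs as tuples. -/
def GuardedMETA.equivProd (nX nE : ℕ) :
    GuardedMETA nX nE ≃ ℕ × ℕ × List (LocData nX nE) × ℕ × List (Edge nX nE) where
  toFun A := (A.numActions, A.numProps, A.locs, A.init, A.edges)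
  invFun p := ⟨p.1, p.2.1, p.2.2.1, p.2.2.2.1, p.2.2.2.2⟩
  left_inv _ := rfl
  right_inv _ := rfl

instance (nX nE : ℕ) : Primcodable (GuardedMETA nX nE) :=
  Primcodable.ofEquiv _ (GuardedMETA.equivProd nX nE)

end Encoding

namespace GuardedMETA

variable {nX nE : ℕ}

/-- `l` is a private location. -/
def IsPriv (A : GuardedMETA nX nE) (l : ℕ) : Prop := ∃ L, A.locs[l]? = some L ∧ L.isPriv = true

/-- `l` is a final location. -/
def IsFinal (A : GuardedMETA nX nE) (l : ℕ) : Prop := ∃ L, A.locs[l]? = some L ∧ L.isFinal = true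

/-- The data `A` form a guarded META: the initial location and the sources and targets of edges are
locations, labels and actions are taken from the given sets, there is a private location and a
final location, no location is both, final locations have no outgoing edges, and the zero
valuations satisfy the invariant of the initial location. -/
structure WellFormed (A : GuardedMETA nX nE) : Prop where
  init_lt : A.init < A.locs.length
  label_lt : ∀ L ∈ A.locs, ∀ p ∈ L.label, p < A.numProps
  src_lt : ∀ e ∈ A.edges, e.src < A.locs.length
  tgt_lt : ∀ e ∈ A.edges, e.tgt < A.locs.length
  act_lt : ∀ e ∈ A.edges, ∀ a ∈ e.act, a < A.numActions
  exists_priv : ∃ l, A.IsPriv l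
  exists_final : ∃ l, A.IsFinal l
  not_priv_of_final : ∀ l, A.IsFinal l → ¬ A.IsPriv l
  final_no_edge : ∀ e ∈ A.edges, ¬ A.IsFinal e.src
  init_inv : ∀ L, A.locs[A.init]? = some L → L.inv.Sat (fun _ => 0) (fun _ => 0)

/-- All energy rates are `0`, so that energy variables change only along edges. -/
def IsDiscrete (A : GuardedMETA nX nE) : Prop := ∀ L ∈ A.locs, ∀ η, L.rate η = 0

/-- A location together with a clock valuation and an energy valuation. -/
@[ext] structure Config (nX nE : ℕ) where
  loc : ℕ
  clock : Fin nX → ℝ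
  energy : Fin nE → ℝ

/-- The concrete states: the values are nonnegative and the invariant of the location holds. -/
def IsState (A : GuardedMETA nX nE) (s : Config nX nE) : Prop :=
  (∀ x, 0 ≤ s.clock x) ∧ (∀ η, 0 ≤ s.energy η) ∧
    ∃ L, A.locs[s.loc]? = some L ∧ L.inv.Sat s.clock s.energy

/-- The initial state. -/
def initState (A : GuardedMETA nX nE) : Config nX nE := ⟨A.init, fun _ => 0, fun _ => 0⟩

/-- Letting `d` time units elapse, with energy rates `fl`. -/
def Config.elapse (s : Config nX nE) (fl : Fin nE → ℤ) (d : ℝ) : Config nX nE :=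
  ⟨s.loc, fun x => s.clock x + d, fun η => s.energy η + (fl η : ℝ) * d⟩

/-- Delay transitions. -/
def Delay (A : GuardedMETA nX nE) (s : Config nX nE) (d : ℝ) (s' : Config nX nE) : Prop :=
  0 ≤ d ∧ ∃ L, A.locs[s.loc]? = some L ∧ s' = s.elapse L.rate d ∧
    ∀ d' ∈ Set.Icc 0 d, A.IsState (s.elapse L.rate d')

/-- Discrete transitions. -/
def Fire (A : GuardedMETA nX nE) (s : Config nX nE) (e : Edge nX nE) (s' : Config nX nE) : Prop :=
  e ∈ A.edges ∧ A.IsState s ∧ A.IsState s' ∧ s.loc = e.src ∧ s'.loc = e.tgt ∧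
    e.guard.Sat s.clock s.energy ∧
    (∀ x, s'.clock x = if e.reset x = true then 0 else s.clock x) ∧
    (∀ η, s'.energy η = s.energy η + (e.update η : ℝ))

/-- A delay followed by a discrete transition. -/
def Step (A : GuardedMETA nX nE) (s : Config nX nE) (d : ℝ) (e : Edge nX nE)
    (s' : Config nX nE) : Prop :=
  ∃ s'', A.Delay s d s'' ∧ A.Fire s'' e s'

/-- One step of a run: the delay, the edge, and the state reached. -/
structure RunStep (nX nE : ℕ) where
  delay : ℝ
  edge : Edge nX nE
  target : Config nX nE

/-- The sequence of steps `ρ` is a path of the transition system from the state `s`. -/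
inductive IsPath (A : GuardedMETA nX nE) : Config nX nE → List (RunStep nX nE) → Prop
  | nil {s} : A.IsState s → IsPath A s []
  | cons {s d e s' ρ} : A.Step s d e s' → IsPath A s' ρ → IsPath A s (⟨d, e, s'⟩ :: ρ)

/-- `ρ` is (the sequence of steps of) a run, from the initial state. -/
def IsRun (A : GuardedMETA nX nE) (ρ : List (RunStep nX nE)) : Prop := A.IsPath A.initState ρ

/-- The states that belong to a run, in order. -/
def states (A : GuardedMETA nX nE) (ρ : List (RunStep nX nE)) : List (Config nX nE) :=
  A.initState :: ρ.map RunStep.target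

/-- The last state of a run. -/
def lastState (A : GuardedMETA nX nE) (ρ : List (RunStep nX nE)) : Config nX nE :=
  (A.states ρ).getLast (List.cons_ne_nil _ _)

/-- The duration of a sequence of steps. -/
def duration (ρ : List (RunStep nX nE)) : ℝ := (ρ.map RunStep.delay).sum

/-- Private runs: they end in a final location and visit a private location. -/
def IsPrivateRun (A : GuardedMETA nX nE) (ρ : List (RunStep nX nE)) : Prop :=
  A.IsRun ρ ∧ A.IsFinal (A.lastState ρ).loc ∧ ∃ s ∈ A.states ρ, A.IsPriv s.loc

/-- Public runs: they end in a final location and visit no private location. -/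
def IsPublicRun (A : GuardedMETA nX nE) (ρ : List (RunStep nX nE)) : Prop :=
  A.IsRun ρ ∧ A.IsFinal (A.lastState ρ).loc ∧ ∀ s ∈ A.states ρ, ¬ A.IsPriv s.loc

open Classical in
/-- The energy level at time `t ≥ 0` of a run of a discrete guarded META: the energy valuation
after the largest number `k` of steps that are completed at time `t`, i.e. whose delays sum up to
at most `t` (the zero valuation if `k = 0`). -/
noncomputable def energyLevel (A : GuardedMETA nX nE) (ρ : List (RunStep nX nE)) (t : ℝ) :
    Fin nE → ℝ :=
  (A.lastState (ρ.take (Nat.findGreatest (fun k => duration (ρ.take k) ≤ t) ρ.length))).energy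

/-- The discrete energy observation of a run: its energy levels at the times `1, …, k`, where `k`
is the duration rounded up. -/
noncomputable def DEO (A : GuardedMETA nX nE) (ρ : List (RunStep nX nE)) : List (Fin nE → ℝ) :=
  (List.range ⌈duration ρ⌉₊).map fun i => A.energyLevel ρ ((i : ℝ) + 1)

end GuardedMETA

/-- The three variants of opacity. -/
inductive OpacityKind where
  | exist | weak | full

/-- Discrete-energy opacity, in its three variants. -/
def GuardedMETA.DEOpaque {nX nE : ℕ} (A : GuardedMETA nX nE) : OpacityKind → Prop
  | .exist => ∃ ρ ρ', A.IsPrivateRun ρ ∧ A.IsPublicRun ρ' ∧ A.DEO ρ = A.DEO ρ'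
  | .weak => ∀ ρ, A.IsPrivateRun ρ → ∃ ρ', A.IsPublicRun ρ' ∧ A.DEO ρ = A.DEO ρ'
  | .full => (∀ ρ, A.IsPrivateRun ρ → ∃ ρ', A.IsPublicRun ρ' ∧ A.DEO ρ = A.DEO ρ') ∧
      ∀ ρ', A.IsPublicRun ρ' → ∃ ρ, A.IsPrivateRun ρ ∧ A.DEO ρ = A.DEO ρ'

/-- The problem `P`, with the elements of `C` as instances, is decidable: some partial recursive
function halts on all instances in `C` and answers correctly whether `P` holds (what it does on
inputs outside `C` is irrelevant). -/
def DecidableOn {α : Type} [Primcodable α] (C : Set α) (P : α → Prop) : Prop :=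
  ∃ f : α →. Bool, Partrec f ∧ ∀ a ∈ C, ∃ b ∈ f a, (b = true ↔ P a)

/-! The halting problem is reduced to opacity. The automaton built here has a private branch that
ends at time `1` with both energies `0`, and a public branch whose energies are the two registers of
a Minsky machine; the public branch performs any number of instructions at time `0` and can end only
at time `1` with both energies `0`. All complete runs then have the same observation and a private
one exists, so each variant of opacity says that a public run exists, that is, that the machine
accepts.

Machines are obtained from structured programs: the relations generated by increments, decrements
and zero tests under composition, union and iteration. Primitive recursive functions are implemented
by such programs with registers indexed by `ℕ`, unbounded search is iteration with a guessed number
of rounds, Gödel numbering reduces the registers to two, and Kleene's theorem (by Brzozowski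
derivatives) turns a program into a finite automaton over the instructions. -/

section RegularLanguages

open scoped Computability
open Language

variable {α : Type*} {L M : Language α}

theorem isRegular_of_mem_finite_closed {F : Set (Language α)} (hF : F.Finite)
    (hclosed : ∀ K ∈ F, ∀ a, K.leftQuotient [a] ∈ F) (hL : L ∈ F) : L.IsRegular := by
  refine .of_finite_range_leftQuotient (hF.subset ?_)
  rintro _ ⟨x, rfl⟩
  induction x using List.reverseRecOn with
  | nil => exact hL
  | append_singleton x a ih =>
    rw [leftQuotient_append]
    exact hclosed _ ih a

theorem leftQuotient_mem_range_leftQuotient {K : Language α} (hK : K ∈ Set.range L.leftQuotient)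
    (x : List α) : K.leftQuotient x ∈ Set.range L.leftQuotient := by
  obtain ⟨y, rfl⟩ := hK
  exact ⟨y ++ x, leftQuotient_append ..⟩

theorem leftQuotient_zero (x : List α) : (0 : Language α).leftQuotient x = 0 := rfl

theorem leftQuotient_one_singleton (a : α) : (1 : Language α).leftQuotient [a] = 0 := by
  ext y
  simp [mem_leftQuotient, mem_one, notMem_zero]

theorem leftQuotient_add (x : List α) :
    (L + M).leftQuotient x = L.leftQuotient x + M.leftQuotient x := rfl

theorem mem_language_sSup {S : Set (Language α)} {x : List α} : x ∈ sSup S ↔ ∃ N ∈ S, x ∈ N :=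
  Set.mem_sUnion

theorem leftQuotient_sSup (S : Set (Language α)) (x : List α) :
    (sSup S).leftQuotient x = sSup ((fun N => N.leftQuotient x) '' S) := by
  ext y
  simp [mem_leftQuotient, mem_language_sSup]

open Classical in
theorem leftQuotient_mul_singleton (L M : Language α) (a : α) :
    (L * M).leftQuotient [a] =
      L.leftQuotient [a] * M + if [] ∈ L then M.leftQuotient [a] else 0 := by
  have hite (z : List α) :
      (z ∈ if [] ∈ L then M.leftQuotient [a] else 0) ↔ [] ∈ L ∧ a :: z ∈ M := by
    split_ifs with h <;> simp [h, mem_leftQuotient, notMem_zero]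
  ext z
  simp only [mem_add, mem_mul, mem_leftQuotient, hite, List.singleton_append]
  constructor
  · rintro ⟨u, hu, v, hv, h⟩
    obtain ⟨rfl, rfl⟩ | ⟨u, rfl, rfl⟩ := List.append_eq_cons_iff.1 h
    · exact .inr ⟨hu, hv⟩
    · exact .inl ⟨u, hu, v, hv, rfl⟩
  · rintro (⟨u, hu, v, hv, rfl⟩ | ⟨hL, hM⟩)
    · exact ⟨a :: u, hu, v, hv, rfl⟩
    · exact ⟨[], hL, a :: z, hM, rfl⟩

theorem leftQuotient_kstar_singleton (L : Language α) (a : α) :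
    L∗.leftQuotient [a] = L.leftQuotient [a] * L∗ := by
  ext z
  rw [mem_leftQuotient, mem_mul]
  constructor
  · rw [mem_kstar_iff_exists_nonempty]
    rintro ⟨_ | ⟨_ | ⟨b, u⟩, S⟩, h, hS⟩
    · simp at h
    · exact absurd rfl (hS [] (by simp)).2
    · obtain ⟨rfl, rfl⟩ : a = b ∧ z = u ++ S.flatten := by simpa using h
      exact ⟨u, (hS _ (by simp)).1, _, join_mem_kstar fun y hy => (hS y (by simp [hy])).1, rfl⟩
  · rintro ⟨u, hu, _, ⟨S, rfl, hS⟩, rfl⟩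
    exact ⟨(a :: u) :: S, rfl, List.forall_mem_cons.2 ⟨hu, hS⟩⟩

theorem isRegular_language_zero : (0 : Language α).IsRegular :=
  isRegular_of_mem_finite_closed (Set.finite_singleton 0) (by simp [leftQuotient_zero]) rfl

theorem isRegular_language_one : (1 : Language α).IsRegular :=
  isRegular_of_mem_finite_closed (Set.toFinite {1, 0})
    (by simp [leftQuotient_one_singleton, leftQuotient_zero]) (by simp)

theorem isRegular_language_singleton (a : α) : ({[a]} : Language α).IsRegular := by
  have hquotient (b : α) : ({[a]} : Language α).leftQuotient [b] ∈ ({1, 0} : Set _) := by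
    by_cases h : b = a
    · left
      ext y
      change b :: y = [a] ↔ y = []
      simp [h]
    · right
      ext y
      change b :: y = [a] ↔ y ∈ (0 : Language α)
      simp [h, notMem_zero]
  refine isRegular_of_mem_finite_closed (Set.toFinite {{[a]}, 1, 0}) ?_ (by simp)
  rintro _ (rfl | rfl | rfl) b
  · exact .inr (hquotient b)
  · simp [leftQuotient_one_singleton]
  · simp [leftQuotient_zero]

open Classical in
theorem isRegular_language_mul (hL : L.IsRegular) (hM : M.IsRegular) : (L * M).IsRegular := by
  refine isRegular_of_mem_finite_closed
    ((hL.finite_range_leftQuotient.prod hM.finite_range_leftQuotient.finite_subsets).image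
      fun q : Language α × Set (Language α) => q.1 * M + sSup q.2) ?_
    ⟨(L, ∅), ⟨⟨[], rfl⟩, Set.empty_subset _⟩, by simp⟩
  rintro _ ⟨⟨K, T⟩, ⟨hK, hT⟩, rfl⟩ a
  refine ⟨(K.leftQuotient [a], (if [] ∈ K then {M.leftQuotient [a]} else ∅) ∪
    (fun N => N.leftQuotient [a]) '' T), ⟨leftQuotient_mem_range_leftQuotient hK _, ?_⟩, ?_⟩
  · refine Set.union_subset ?_ (Set.image_subset_iff.2 fun N hN =>
      leftQuotient_mem_range_leftQuotient (hT hN) _)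
    split_ifs <;> simp
  · dsimp only
    rw [leftQuotient_add, leftQuotient_mul_singleton, leftQuotient_sSup, sSup_union, add_assoc]
    split_ifs <;> simp

open Classical in
theorem isRegular_language_kstar (hL : L.IsRegular) : L∗.IsRegular := by
  refine isRegular_of_mem_finite_closed
    ((hL.finite_range_leftQuotient.finite_subsets.image fun T => sSup T * L∗).insert L∗) ?_
    (Set.mem_insert _ _)
  rintro _ (rfl | ⟨T, hT, rfl⟩) a
  · exact .inr ⟨{L.leftQuotient [a]}, by simp, by simp [leftQuotient_kstar_singleton]⟩
  · refine .inr ⟨(if [] ∈ sSup T then {L.leftQuotient [a]} else ∅) ∪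
      (fun N => N.leftQuotient [a]) '' T, ?_, ?_⟩
    · refine Set.union_subset ?_ (Set.image_subset_iff.2 fun N hN =>
        leftQuotient_mem_range_leftQuotient (hT hN) _)
      split_ifs <;> simp
    · dsimp only
      rw [leftQuotient_mul_singleton, leftQuotient_kstar_singleton, leftQuotient_sSup, sSup_union]
      split_ifs <;> simp [← add_eq_sup, add_mul, add_comm]

end RegularLanguages

section RationalRelations

open Relation
open scoped Computability

/-- The rational relations over a family of letters `R a`: those obtained by composition, union and
iteration, as in regular expressions. They serve as structured programs over the instructions `R`,
a test being a relation `fun s s' => T s ∧ s' = s`. -/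
inductive IsRational {α S : Type*} (R : α → S → S → Prop) : (S → S → Prop) → Prop
  | letter (a : α) : IsRational R (R a)
  | empty : IsRational R fun _ _ => False
  | one : IsRational R fun s s' => s' = s
  | comp {P Q} : IsRational R P → IsRational R Q → IsRational R (Comp P Q)
  | union {P Q} : IsRational R P → IsRational R Q → IsRational R fun s s' => P s s' ∨ Q s s'
  | star {P} : IsRational R P → IsRational R (ReflTransGen P)

variable {α β S S' : Type*} {R : α → S → S → Prop} {R' : β → S' → S' → Prop}
  {P Q : S → S → Prop}

namespace IsRational

theorem congr (hP : IsRational R P) (h : ∀ s s', P s s' ↔ Q s s') : IsRational R Q :=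
  (funext₂ fun s s' => propext (h s s') : P = Q) ▸ hP

theorem flip (hR : ∀ a, IsRational R (flip (R a))) (hP : IsRational R P) :
    IsRational R (flip P) := by
  induction hP with
  | letter a => exact hR a
  | empty => exact empty
  | one => exact one.congr fun _ _ => eq_comm
  | comp _ _ ihP ihQ =>
    exact (ihQ.comp ihP).congr fun _ _ => by simp only [Comp, Function.flip_def, and_comm]
  | union _ _ ihP ihQ => exact ihP.union ihQ
  | star _ ih => exact ih.star.congr fun _ _ => reflTransGen_swap

theorem test_range {T : S → Prop} {F : S → S} (hR : ∀ a, IsRational R (_root_.flip (R a)))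
    (h : IsRational R fun s s' => T s ∧ s' = F s) :
    IsRational R fun s s' => (∃ t, T t ∧ F t = s) ∧ s' = s := by
  refine ((h.flip hR).comp h).congr fun s s' => ?_
  simp only [Comp, Function.flip_def]
  constructor
  · rintro ⟨t, ⟨ht, rfl⟩, -, rfl⟩
    exact ⟨⟨t, ht, rfl⟩, rfl⟩
  · rintro ⟨⟨t, ht, rfl⟩, rfl⟩
    exact ⟨t, ⟨ht, rfl⟩, ht, rfl⟩

end IsRational

/-- The relation obtained by performing the letters of a word in turn. -/
def wordRel (R : α → S → S → Prop) (w : List α) : S → S → Prop :=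
  w.foldr (fun a P => Comp (R a) P) Eq

theorem wordRel_append (u v : List α) :
    wordRel R (u ++ v) = Comp (wordRel R u) (wordRel R v) := by
  induction u with
  | nil => exact (eq_comp ..).symm
  | cons a u ih => exact (congrArg (Comp (R a)) ih).trans (comp_assoc ..).symm

/-- The union of the relations given by the words of a language. -/
def langRel (R : α → S → S → Prop) (L : Language α) (s s' : S) : Prop :=
  ∃ w ∈ L, wordRel R w s s'

theorem langRel_singleton (a : α) : langRel R {[a]} = R a := by
  funext s s'
  exact propext ⟨fun ⟨_, hw, h⟩ => by subst hw; simpa [wordRel] using h,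
    fun h => ⟨[a], rfl, by simpa [wordRel] using h⟩⟩

theorem langRel_zero : langRel R 0 = fun _ _ => False := by
  funext s s'
  simp [langRel, Language.notMem_zero]

theorem langRel_one : langRel R 1 = Eq := by
  funext s s'
  simp [langRel, wordRel, Language.mem_one]

theorem langRel_add (L M : Language α) :
    langRel R (L + M) = fun s s' => langRel R L s s' ∨ langRel R M s s' := by
  funext s s'
  simp only [langRel, Language.mem_add, or_and_right, exists_or]

theorem langRel_mul (L M : Language α) : langRel R (L * M) = Comp (langRel R L) (langRel R M) := by
  funext s s'
  simp only [langRel, Language.mem_mul, Comp, eq_iff_iff]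
  constructor
  · rintro ⟨_, ⟨u, hu, v, hv, rfl⟩, h⟩
    rw [wordRel_append] at h
    obtain ⟨t, h₁, h₂⟩ := h
    exact ⟨t, ⟨u, hu, h₁⟩, v, hv, h₂⟩
  · rintro ⟨t, ⟨u, hu, h₁⟩, v, hv, h₂⟩
    exact ⟨_, ⟨u, hu, v, hv, rfl⟩, wordRel_append (R := R) u v ▸ ⟨t, h₁, h₂⟩⟩

theorem langRel_kstar (L : Language α) : langRel R L∗ = ReflTransGen (langRel R L) := by
  funext s s'
  refine propext ⟨?_, fun h => ?_⟩
  · rintro ⟨_, ⟨S, rfl, hS⟩, h⟩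
    induction S generalizing s with
    | nil =>
      obtain rfl : s = s' := h
      exact .refl
    | cons u S ih =>
      rw [List.flatten_cons, wordRel_append] at h
      obtain ⟨t, hu, h⟩ := h
      exact .head ⟨u, hS u (by simp), hu⟩ (ih t (fun y hy => hS y (by simp [hy])) h)
  · induction h using ReflTransGen.head_induction_on with
    | refl => exact ⟨[], Language.nil_mem_kstar L, rfl⟩
    | head hst _ ih =>
      rw [← Language.one_add_self_mul_kstar_eq_kstar, langRel_add, langRel_mul]
      exact .inr ⟨_, hst, ih⟩

theorem IsRational.exists_isRegular (hP : IsRational R P) :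
    ∃ L : Language α, L.IsRegular ∧ langRel R L = P := by
  induction hP with
  | letter a => exact ⟨{[a]}, isRegular_language_singleton a, langRel_singleton a⟩
  | empty => exact ⟨0, isRegular_language_zero, langRel_zero⟩
  | one => exact ⟨1, isRegular_language_one, langRel_one.trans (funext₂ fun _ _ => propext eq_comm)⟩
  | comp _ _ ihP ihQ =>
    obtain ⟨⟨L, hL, rfl⟩, M, hM, rfl⟩ := And.intro ihP ihQ
    exact ⟨L * M, isRegular_language_mul hL hM, langRel_mul L M⟩
  | union _ _ ihP ihQ =>
    obtain ⟨⟨L, hL, rfl⟩, M, hM, rfl⟩ := And.intro ihP ihQ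
    exact ⟨L + M, hL.add hM, langRel_add L M⟩
  | star _ ih =>
    obtain ⟨L, hL, rfl⟩ := ih
    exact ⟨L∗, isRegular_language_kstar hL, langRel_kstar L⟩

/-- `Q` acts on the codes `e s` as `P` acts on `s`, and leads from codes to codes only. -/
def Simulates (e : S → S') (Q : S' → S' → Prop) (P : S → S → Prop) : Prop :=
  ∀ s t, Q (e s) t ↔ ∃ s', P s s' ∧ e s' = t

theorem Simulates.star {e : S → S'} {Q : S' → S' → Prop} (h : Simulates e Q P) :
    Simulates e (ReflTransGen Q) (ReflTransGen P) := by
  intro s t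
  constructor
  · intro hQ
    induction hQ with
    | refl => exact ⟨s, .refl, rfl⟩
    | tail _ hbc ih =>
      obtain ⟨s', hP, rfl⟩ := ih
      obtain ⟨s'', hP', rfl⟩ := (h _ _).1 hbc
      exact ⟨s'', hP.tail hP', rfl⟩
  · rintro ⟨s', hP, rfl⟩
    exact hP.lift e fun s s' hss' => (h s _).2 ⟨s', hss', rfl⟩

theorem IsRational.exists_simulates {e : S → S'}
    (hR : ∀ a, ∃ Q, IsRational R' Q ∧ Simulates e Q (R a)) (hP : IsRational R P) :
    ∃ Q, IsRational R' Q ∧ Simulates e Q P := by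
  induction hP with
  | letter a => exact hR a
  | empty => exact ⟨_, .empty, fun _ _ => by simp⟩
  | one => exact ⟨_, .one, fun _ _ => by simp [eq_comm]⟩
  | comp _ _ ihP ihQ =>
    obtain ⟨⟨P', hP', hPP'⟩, Q', hQ', hQQ'⟩ := And.intro ihP ihQ
    refine ⟨_, hP'.comp hQ', fun s t => ⟨?_, ?_⟩⟩
    · rintro ⟨_, hst, ht⟩
      obtain ⟨s', hss', rfl⟩ := (hPP' _ _).1 hst
      obtain ⟨s'', hs's'', rfl⟩ := (hQQ' _ _).1 ht
      exact ⟨s'', ⟨s', hss', hs's''⟩, rfl⟩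
    · rintro ⟨s'', ⟨s', hss', hs's''⟩, rfl⟩
      exact ⟨e s', (hPP' _ _).2 ⟨s', hss', rfl⟩, (hQQ' _ _).2 ⟨s'', hs's'', rfl⟩⟩
  | union _ _ ihP ihQ =>
    obtain ⟨⟨P', hP', hPP'⟩, Q', hQ', hQQ'⟩ := And.intro ihP ihQ
    exact ⟨_, hP'.union hQ', fun s t => by
      simp only [hPP' s t, hQQ' s t, or_and_right, exists_or]⟩
  | star _ ih =>
    obtain ⟨Q, hQ, h⟩ := ih
    exact ⟨_, hQ.star, h.star⟩

/-- Some program over the letters `R` terminates from every state and meets the specification `Φ`,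
which relates the initial to the final states. -/
def IsImplementable (R : α → S → S → Prop) (Φ : S → S → Prop) : Prop :=
  ∃ P, IsRational R P ∧ (∀ s, ∃ s', P s s') ∧ ∀ s s', P s s' → Φ s s'

namespace IsImplementable

variable {Φ Ψ : S → S → Prop}

theorem mono (hΦ : IsImplementable R Φ) (h : ∀ s s', Φ s s' → Ψ s s') : IsImplementable R Ψ :=
  let ⟨P, hP, htotal, hPΦ⟩ := hΦ
  ⟨P, hP, htotal, fun s s' hs => h s s' (hPΦ s s' hs)⟩

theorem comp (hΦ : IsImplementable R Φ) (hΨ : IsImplementable R Ψ) :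
    IsImplementable R (Comp Φ Ψ) := by
  obtain ⟨P, hP, hPtotal, hPΦ⟩ := hΦ
  obtain ⟨Q, hQ, hQtotal, hQΨ⟩ := hΨ
  refine ⟨_, hP.comp hQ, fun s => ?_, fun s s'' => ?_⟩
  · obtain ⟨s', hs'⟩ := hPtotal s
    obtain ⟨s'', hs''⟩ := hQtotal s'
    exact ⟨s'', s', hs', hs''⟩
  · rintro ⟨s', hs', hs''⟩
    exact ⟨s', hPΦ _ _ hs', hQΨ _ _ hs''⟩

theorem _root_.IsRational.isImplementable {F : S → S} (h : IsRational R fun s s' => s' = F s) :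
    IsImplementable R fun s s' => s' = F s :=
  ⟨_, h, fun s => ⟨F s, rfl⟩, fun _ _ => id⟩

/-- The program guesses the number of rounds and the test `T` confirms the guess. -/
theorem repeat_until {I : S → ℕ → S → Prop} {T : S → Prop} {n : S → ℕ}
    (hinit : IsImplementable R fun s s' => I s 0 s') (hbody : IsImplementable R Φ)
    (hstep : ∀ s k t t', I s k t → Φ t t' → I s (k + 1) t')
    (htest : IsRational R fun s s' => T s ∧ s' = s) (hT : ∀ s k t, I s k t → (T t ↔ k = n s)) :
    IsImplementable R fun s s' => I s (n s) s' := by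
  obtain ⟨P₀, hP₀, htotal₀, hI₀⟩ := hinit
  obtain ⟨P, hP, htotal, hPΦ⟩ := hbody
  refine ⟨_, (hP₀.comp hP.star).comp htest, fun s => ?_, ?_⟩
  · have hreach (k : ℕ) : ∃ t, Comp P₀ (ReflTransGen P) s t ∧ I s k t := by
      induction k with
      | zero =>
        obtain ⟨t, ht⟩ := htotal₀ s
        exact ⟨t, ⟨t, ht, .refl⟩, hI₀ s t ht⟩
      | succ k ih =>
        obtain ⟨t, ⟨s₀, hs₀, hs₀t⟩, hI⟩ := ih
        obtain ⟨t', ht'⟩ := htotal t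
        exact ⟨t', ⟨s₀, hs₀, hs₀t.tail ht'⟩, hstep s k t t' hI (hPΦ t t' ht')⟩
    obtain ⟨t, hst, hI⟩ := hreach (n s)
    exact ⟨t, t, hst, (hT s _ t hI).2 rfl, rfl⟩
  · rintro s t ⟨_, ⟨s₀, hs₀, hs₀t⟩, htest, rfl⟩
    obtain ⟨k, hI⟩ : ∃ k, I s k t := by
      clear htest
      induction hs₀t with
      | refl => exact ⟨0, hI₀ s s₀ hs₀⟩
      | tail _ h ih =>
        obtain ⟨k, hI⟩ := ih
        exact ⟨k + 1, hstep s k _ _ hI (hPΦ _ _ h)⟩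
    exact (hT s k t hI).1 htest ▸ hI

end IsImplementable

end RationalRelations

/-- Instructions of a register machine: increment, decrement and zero test of a register. -/
inductive RegOp (ι : Type*) where
  | inc (r : ι)
  | dec (r : ι)
  | zero (r : ι)

namespace RegOp

open Finsupp Relation

variable {ι : Type*}

instance [Finite ι] : Finite (RegOp ι) := by
  refine Finite.of_injective (β := Fin 3 × ι) (fun
    | inc r => (0, r)
    | dec r => (1, r)
    | zero r => (2, r)) ?_
  rintro (r | r | r) (s | s | s) h <;> simp_all

/-- The effect of an instruction on the register contents; a decrement fails at `0`. -/
def Rel : RegOp ι → (ι →₀ ℕ) → (ι →₀ ℕ) → Prop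
  | inc r, σ, σ' => σ' = σ + single r 1
  | dec r, σ, σ' => σ = σ' + single r 1
  | zero r, σ, σ' => σ r = 0 ∧ σ' = σ

theorem isRational_flip_rel (a : RegOp ι) : IsRational Rel (flip (Rel a)) := by
  cases a with
  | inc r => exact .letter (dec r)
  | dec r => exact .letter (inc r)
  | zero r =>
    refine (IsRational.letter (R := Rel) (zero r)).congr fun σ σ' => ?_
    simp only [Rel, Function.flip_def]
    constructor <;> rintro ⟨h, rfl⟩ <;> exact ⟨h, rfl⟩

theorem isRational_add (τ : ι →₀ ℕ) : IsRational Rel fun σ σ' => σ' = σ + τ := by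
  have hone : IsRational (Rel (ι := ι)) fun σ σ' => σ' = σ := .one
  induction τ using Finsupp.induction_linear with
  | zero => simpa using hone
  | add f g hf hg => exact (hf.comp hg).congr fun σ σ' => by simp [Comp, add_assoc]
  | single r b =>
    induction b with
    | zero => simpa using hone
    | succ b ih =>
      exact (ih.comp (.letter (inc r))).congr fun σ σ' => by
        simp [Comp, Rel, add_assoc, ← single_add]

theorem exists_eq_add_single {σ : ι →₀ ℕ} {r : ι} (h : σ r ≠ 0) : ∃ ρ, σ = ρ + single r 1 :=
  ⟨σ - single r 1, (tsub_add_cancel_of_le (single_le_iff.2 (Nat.one_le_iff_ne_zero.2 h))).symm⟩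

theorem isRational_drain {x : ι} {τ : ι →₀ ℕ} (hτ : τ x = 0) :
    IsRational Rel fun σ σ' => σ' = σ.erase x + σ x • τ := by
  have hround (ρ : ι →₀ ℕ) :
      (ρ + single x 1 : ι →₀ ℕ).erase x + (ρ + single x 1 : ι →₀ ℕ) x • τ =
        (ρ + τ).erase x + (ρ + τ) x • τ := by
    simp only [erase_add, erase_single, Finsupp.add_apply, single_eq_same, hτ, add_smul, one_smul,
      erase_of_notMem_support (notMem_support_iff.2 hτ)]
    abel
  refine (((IsRational.letter (dec x)).comp (isRational_add τ)).star.comp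
    (.letter (zero x))).congr fun σ σ' => ?_
  constructor
  · rintro ⟨_, h, hzero, rfl⟩
    induction h using ReflTransGen.head_induction_on with
    | refl => simp [hzero]
    | head h _ ih =>
      obtain ⟨ρ, rfl, rfl⟩ := h
      rw [ih, hround]
  · rintro rfl
    refine ⟨_, ?_, by simp [hτ], rfl⟩
    induction hn : σ x generalizing σ with
    | zero => simpa [hn] using ReflTransGen.refl
    | succ n ih =>
      obtain ⟨ρ, rfl⟩ := exists_eq_add_single (σ := σ) (r := x) (by omega)
      have hρ : (ρ + τ) x = n := by simpa [hτ] using hn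
      rw [← hn, hround, hρ]
      exact .head ⟨ρ, rfl, rfl⟩ (ih _ hρ)

theorem isRational_clear (x : ι) : IsRational Rel fun σ σ' => σ' = σ.erase x := by
  simpa using isRational_drain (τ := 0) (x := x) rfl

theorem isRational_move {x y : ι} (h : x ≠ y) :
    IsRational Rel fun σ σ' => σ' = σ.erase x + single y (σ x) := by
  classical
  simpa using isRational_drain (τ := single y 1) (single_eq_of_ne h)

theorem isRational_test_const (x : ι) (j : ℕ) :
    IsRational Rel fun σ σ' : ι →₀ ℕ => σ x = j ∧ σ' = σ := by
  have h : IsRational Rel fun σ σ' => σ x = 0 ∧ σ' = σ + single x j :=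
    ((IsRational.letter (zero x)).comp (isRational_add (single x j))).congr fun σ σ' => by
      simp [Comp, Rel, and_assoc]
  refine (h.test_range isRational_flip_rel).congr fun σ σ' => and_congr_left' ⟨?_, fun hσ => ?_⟩
  · rintro ⟨τ, hτ, rfl⟩
    simp [hτ]
  · exact ⟨σ.erase x, erase_same, by rw [← hσ, erase_add_single]⟩

/-- The range of the program that drains `t` into both `x` and `y`, started at `x = y = 0`. -/
theorem isRational_test_eq {x y t : ι} (hxy : x ≠ y) (hxt : x ≠ t) (hyt : y ≠ t) :
    IsRational Rel fun σ σ' : ι →₀ ℕ => (σ x = σ y ∧ σ t = 0) ∧ σ' = σ := by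
  classical
  have h : IsRational Rel fun σ σ' : ι →₀ ℕ =>
      (σ x = 0 ∧ σ y = 0) ∧ σ' = σ.erase t + σ t • (single x 1 + single y 1) :=
    (((IsRational.letter (zero x)).comp (.letter (zero y))).comp
      (isRational_drain (x := t) (τ := single x 1 + single y 1) (by simp [hxt, hyt]))).congr
      fun σ σ' => by simp [Comp, Rel, and_assoc]
  refine (h.test_range isRational_flip_rel).congr fun σ σ' => and_congr_left' ⟨?_, fun hσ => ?_⟩
  · rintro ⟨τ, ⟨hx, hy⟩, rfl⟩
    simp [hx, hy, hxy, hxy.symm, hxt, hyt, hxt.symm, hyt.symm, erase_ne]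
  · refine ⟨(σ.erase x).erase y + single t (σ x), by simp [hxy, hxt, hyt, erase_ne], ?_⟩
    ext r
    simp only [Finsupp.add_apply, Finsupp.smul_apply, Finsupp.single_apply, Finsupp.erase_apply,
      smul_eq_mul]
    grind

theorem isImplementable_copy {x y t : ι} (hxy : x ≠ y) (hxt : x ≠ t) (hyt : y ≠ t) :
    IsImplementable Rel fun σ σ' : ι →₀ ℕ => (∀ r, r ≠ y → r ≠ t → σ' r = σ r) ∧ σ' y = σ x := by
  classical
  refine ((((isRational_clear y).isImplementable.comp (isRational_clear t).isImplementable).comp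
    (isRational_drain (x := x) (τ := single t 1 + single y 1)
      (by simp [hxy, hxt])).isImplementable).comp
    (isRational_move hxt.symm).isImplementable).mono ?_
  rintro σ _ ⟨_, ⟨_, ⟨_, rfl, rfl⟩, rfl⟩, rfl⟩
  simp only [Finsupp.add_apply, Finsupp.smul_apply, Finsupp.single_apply, Finsupp.erase_apply,
    smul_eq_mul]
  grind

end RegOp

section PrimitiveRecursive

open Finsupp Relation RegOp

/-- `f` can be computed by register programs: given input registers below `m`, some program stores
the value of `f` in register `m`, leaving the registers below `m` unchanged and using those above
`m` as working space. -/
def Computes {n : ℕ} (f : List.Vector ℕ n → ℕ) : Prop :=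
  ∀ (m : ℕ) (x : Fin n → ℕ), (∀ i, x i < m) → IsImplementable Rel fun σ σ' : ℕ →₀ ℕ =>
    (∀ r < m, σ' r = σ r) ∧ σ' m = f (List.Vector.ofFn fun i => σ (x i))

theorem computes_get {n : ℕ} (i : Fin n) : Computes fun v => v.get i := by
  intro m x hx
  have hi := hx i
  refine (isImplementable_copy (x := x i) (y := m) (t := m + 1) (by omega) (by omega)
    (by omega)).mono fun σ σ' h => ⟨fun r hr => h.1 r (by omega) (by omega), ?_⟩
  simp only [h.2, List.Vector.get_ofFn]

theorem computes_zero : @Computes 0 fun _ => 0 := by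
  refine fun m _ _ => (isRational_clear m).isImplementable.mono ?_
  rintro σ _ rfl
  exact ⟨fun r hr => erase_ne hr.ne, erase_same⟩

theorem computes_succ : @Computes 1 fun v => Nat.succ v.head := by
  intro m x hx
  refine ((computes_get 0 m x hx).comp
    (isRational_add (single m 1)).isImplementable).mono ?_
  rintro σ _ ⟨τ, ⟨hlt, hm⟩, rfl⟩
  exact ⟨fun r hr => by simp [hlt r hr, hr.ne'], by simp [hm, ← List.Vector.get_zero]⟩

theorem isImplementable_of_forall_computes {n k : ℕ} {g : Fin n → List.Vector ℕ k → ℕ}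
    (hg : ∀ i, Computes (g i)) {m : ℕ} {x : Fin k → ℕ} (hx : ∀ i, x i < m) :
    IsImplementable Rel fun σ σ' : ℕ →₀ ℕ => (∀ r < m, σ' r = σ r) ∧
      ∀ i : Fin n, σ' (m + i) = g i (List.Vector.ofFn fun i => σ (x i)) := by
  induction n with
  | zero =>
    refine (IsRational.one (R := Rel)).isImplementable (F := id) |>.mono ?_
    rintro σ _ rfl
    exact ⟨fun _ _ => rfl, fun i => i.elim0⟩
  | succ n ih =>
    refine ((ih fun i => hg i.castSucc).comp
      (hg (Fin.last n) (m + n) x fun i => (hx i).trans_le (Nat.le_add_right ..))).mono ?_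
    rintro σ σ' ⟨τ, ⟨hτ, hτg⟩, hσ', hσ'g⟩
    refine ⟨fun r hr => by rw [hσ' r (by omega), hτ r hr], Fin.lastCases ?_ fun i => ?_⟩
    · simp only [Fin.val_last, hσ'g, fun i => hτ (x i) (hx i)]
    · rw [Fin.val_castSucc, hσ' _ (by omega), hτg]

theorem computes_comp {k n : ℕ} {f : List.Vector ℕ n → ℕ} {g : Fin n → List.Vector ℕ k → ℕ}
    (hf : Computes f) (hg : ∀ i, Computes (g i)) :
    Computes fun v => f (List.Vector.ofFn fun i => g i v) := by
  intro m x hx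
  refine ((((isImplementable_of_forall_computes hg fun i => Nat.lt_add_one_of_lt (hx i)).comp
    (hf (m + 1 + n) (fun i => m + 1 + i) fun i => by omega)).comp
    (isRational_clear m).isImplementable).comp
    (isRational_move (x := m + 1 + n) (y := m) (by omega)).isImplementable).mono ?_
  rintro σ _ ⟨_, ⟨τ', ⟨τ, ⟨hτ, hτg⟩, hτ', hτf⟩, rfl⟩, rfl⟩
  simp only [Finsupp.add_apply, Finsupp.single_apply, Finsupp.erase_apply]
  refine ⟨fun r hr => ?_, ?_⟩
  · grind
  · simp [hτf, hτg, show m + 1 + n ≠ m by omega]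

theorem computes_prec {n : ℕ} {f : List.Vector ℕ n → ℕ} {g : List.Vector ℕ (n + 2) → ℕ}
    (hf : Computes f) (hg : Computes g) :
    Computes fun v : List.Vector ℕ (n + 1) =>
      v.head.rec (f v.tail) fun y IH => g (y ::ᵥ IH ::ᵥ v.tail) := by
  intro m x hx
  have hx0 := hx 0
  let v (σ : ℕ →₀ ℕ) := List.Vector.ofFn fun i : Fin n => σ (x i.succ)
  let a (σ : ℕ →₀ ℕ) (k : ℕ) : ℕ := k.rec (f (v σ)) fun y IH => g (y ::ᵥ IH ::ᵥ v σ)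
  let I (σ : ℕ →₀ ℕ) (k : ℕ) (τ : ℕ →₀ ℕ) : Prop :=
    (∀ r < m, τ r = σ r) ∧ τ m = a σ k ∧ τ (m + 1) = k ∧ τ (m + 2) = 0
  have hinit : IsImplementable Rel fun σ τ => I σ 0 τ := by
    refine (((hf m (fun i => x i.succ) fun i => hx _).comp
      (isRational_clear (m + 1)).isImplementable).comp
      (isRational_clear (m + 2)).isImplementable).mono ?_
    rintro σ _ ⟨_, ⟨τ, ⟨hτ, hτf⟩, rfl⟩, rfl⟩
    refine ⟨fun r hr => ?_, by simpa [a, v, erase_ne] using hτf, by simp [erase_ne], erase_same⟩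
    rw [erase_ne (by omega), erase_ne (by omega), hτ r hr]
  have hbody : IsImplementable Rel fun τ τ' : ℕ →₀ ℕ => (∀ r < m, τ' r = τ r) ∧
      τ' m = g (τ (m + 1) ::ᵥ τ m ::ᵥ v τ) ∧ τ' (m + 1) = τ (m + 1) + 1 ∧ τ' (m + 2) = 0 := by
    refine ((((hg (m + 2) (Fin.cons (m + 1) (Fin.cons m fun i => x i.succ)) ?_).comp
      (isRational_clear m).isImplementable).comp
      (isRational_move (x := m + 2) (y := m) (by omega)).isImplementable).comp
      (isRational_add (single (m + 1) 1)).isImplementable).mono ?_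
    · simp only [Fin.forall_fin_succ, Fin.cons_zero, Fin.cons_succ]
      exact ⟨by omega, by omega, fun i => (hx i.succ).trans (by omega)⟩
    · rintro τ _ ⟨_, ⟨_, ⟨τ', ⟨hτ', hτ'g⟩, rfl⟩, rfl⟩, rfl⟩
      have hinputs : (List.Vector.ofFn fun i =>
          τ ((Fin.cons (m + 1) (Fin.cons m fun i => x i.succ) : Fin (n + 2) → ℕ) i)) =
          τ (m + 1) ::ᵥ τ m ::ᵥ v τ := rfl
      rw [hinputs] at hτ'g
      simp only [Finsupp.add_apply, Finsupp.single_apply, Finsupp.erase_apply]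
      grind
  refine (IsImplementable.repeat_until hinit hbody ?_
    (isRational_test_eq (x := x 0) (y := m + 1) (t := m + 2) (by omega) (by omega) (by omega))
    (n := fun σ => σ (x 0)) ?_).mono ?_
  · rintro σ k τ τ' ⟨hτ, hτm, hτk, -⟩ ⟨hτ', hτ'm, hτ'k, hτ'0⟩
    have hv : v τ = v σ := by simp only [v, hτ _ (hx _)]
    exact ⟨fun r hr => (hτ' r hr).trans (hτ r hr), by rw [hτ'm, hτk, hτm, hv], by rw [hτ'k, hτk],
      hτ'0⟩
  · rintro σ k τ ⟨hτ, -, hτk, hτ0⟩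
    simp [hτ _ hx0, hτk, hτ0, eq_comm]
  · rintro σ τ ⟨hτ, hτm, -⟩
    exact ⟨hτ, hτm⟩

theorem computes_of_primrec' {n : ℕ} {f : List.Vector ℕ n → ℕ} (hf : Nat.Primrec' f) :
    Computes f := by
  induction hf with
  | zero => exact computes_zero
  | succ => exact computes_succ
  | get i => exact computes_get i
  | comp g _ _ ihf ihg => exact computes_comp ihf ihg
  | prec _ _ ihf ihg => exact computes_prec ihf ihg

/-- The program guesses a witness `k` and checks it. -/
theorem exists_isRational_of_primrec₂ {p : ℕ → ℕ → ℕ} (hp : Primrec₂ p) :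
    ∃ P, IsRational (Rel (ι := ℕ)) P ∧ ∀ n, (∃ σ, P (single 0 n) σ) ↔ ∃ k, p n k = 0 := by
  obtain ⟨P, hP, htotal, h⟩ := computes_of_primrec' (Nat.Primrec'.prim_iff₂.2 hp) 2 (fun i => i.1)
    fun i => i.2
  have hguess (n : ℕ) (τ : ℕ →₀ ℕ) :
      ReflTransGen (Rel (inc 1)) (single 0 n) τ ↔ ∃ k, τ = single 0 n + single 1 k := by
    constructor
    · intro hτ
      induction hτ with
      | refl => exact ⟨0, by simp⟩
      | tail _ hinc ih =>
        obtain ⟨k, rfl⟩ := ih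
        exact ⟨k + 1, hinc.trans (by simp [add_assoc])⟩
    · rintro ⟨k, rfl⟩
      induction k with
      | zero => simpa using ReflTransGen.refl
      | succ k ih => exact ih.tail (by simp [RegOp.Rel, add_assoc])
  have hcheck {n k : ℕ} {τ : ℕ →₀ ℕ} (hτ : P (single 0 n + single 1 k) τ) : τ 2 = p n k := by
    simpa [List.Vector.ofFn] using (h _ _ hτ).2
  refine ⟨_, ((IsRational.letter (inc 1)).star.comp hP).comp (.letter (zero 2)), fun n => ⟨?_, ?_⟩⟩
  · rintro ⟨σ, τ, ⟨_, hstar, hτ⟩, hzero, rfl⟩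
    obtain ⟨k, rfl⟩ := (hguess n _).1 hstar
    exact ⟨k, hcheck hτ ▸ hzero⟩
  · rintro ⟨k, hk⟩
    obtain ⟨τ, hτ⟩ := htotal (single 0 n + single 1 k)
    exact ⟨τ, τ, ⟨_, (hguess n _).2 ⟨k, rfl⟩, hτ⟩, (hcheck hτ).trans hk, rfl⟩

end PrimitiveRecursive

section TwoRegisters

open Finsupp Relation RegOp

/-- The Gödel number of the contents of countably many registers. -/
noncomputable def godel (σ : ℕ →₀ ℕ) : ℕ := σ.prod fun i a => Nat.nth Nat.Prime i ^ a

theorem godel_add (σ τ : ℕ →₀ ℕ) : godel (σ + τ) = godel σ * godel τ :=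
  Finsupp.prod_add_index' (fun _ => pow_zero _) fun _ _ _ => pow_add ..

theorem godel_single (r a : ℕ) : godel (single r a) = Nat.nth Nat.Prime r ^ a :=
  Finsupp.prod_single_index (pow_zero _)

theorem godel_add_single_one (σ : ℕ →₀ ℕ) (r : ℕ) :
    godel (σ + single r 1) = godel σ * Nat.nth Nat.Prime r := by
  rw [godel_add, godel_single, pow_one]

theorem nth_prime_dvd_godel_iff (σ : ℕ →₀ ℕ) (r : ℕ) :
    Nat.nth Nat.Prime r ∣ godel σ ↔ σ r ≠ 0 := by
  rw [godel, Finsupp.prod, (Nat.prime_nth_prime r).prime.dvd_finsetProd_iff]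
  constructor
  · rintro ⟨i, hi, h⟩
    have hri := (Nat.prime_dvd_prime_iff_eq (Nat.prime_nth_prime r) (Nat.prime_nth_prime i)).1
      ((Nat.prime_nth_prime r).dvd_of_dvd_pow h)
    rw [Nat.nth_injective Nat.infinite_setOfPred_prime hri]
    exact mem_support_iff.1 hi
  · exact fun h => ⟨r, mem_support_iff.2 h, dvd_pow_self _ h⟩

theorem isRational_test_lt {ι : Type*} (x : ι) (p : ℕ) :
    IsRational Rel fun σ σ' : ι →₀ ℕ => (0 < σ x ∧ σ x < p) ∧ σ' = σ := by
  induction p with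
  | zero => exact IsRational.empty.congr fun σ σ' => by simp
  | succ p ih =>
    obtain rfl | hp := Nat.eq_zero_or_pos p
    · exact IsRational.empty.congr fun σ σ' => by simp; omega
    · refine (ih.union (isRational_test_const x p)).congr fun σ σ' => ?_
      rw [← or_and_right]
      exact and_congr_left' (by omega)

theorem isRational_mul (p : ℕ) :
    IsRational Rel fun σ σ' : Fin 2 →₀ ℕ => σ' = single 0 (σ 1 + σ 0 * p) := by
  refine ((isRational_drain (x := 0) (τ := single 1 p) (by simp)).comp
    (isRational_move (x := 1) (y := 0) (by simp))).congr fun σ σ' => ?_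
  simp only [Comp, exists_eq_left]
  refine Eq.congr_right ?_
  ext i
  fin_cases i <;> simp

theorem isRational_div (p : ℕ) :
    IsRational Rel fun σ σ' : Fin 2 →₀ ℕ => σ' 1 = 0 ∧ σ = single 0 (σ' 0 * p) := by
  refine (((isRational_mul p).flip isRational_flip_rel).comp (.letter (zero 1))).congr
    fun σ σ' => ?_
  simp only [Comp, Function.flip_def, RegOp.Rel]
  constructor
  · rintro ⟨_, rfl, h, rfl⟩
    simp [h]
  · rintro ⟨h, rfl⟩
    exact ⟨σ', by simp [h], h, rfl⟩

theorem isRational_test_not_dvd {p : ℕ} (hp : 0 < p) :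
    IsRational Rel fun σ σ' : Fin 2 →₀ ℕ => (σ 1 = 0 ∧ ¬ p ∣ σ 0) ∧ σ' = σ := by
  have h : IsRational Rel fun σ σ' : Fin 2 →₀ ℕ =>
      (0 < σ 1 ∧ σ 1 < p) ∧ σ' = single 0 (σ 1 + σ 0 * p) :=
    ((isRational_test_lt 1 p).comp (isRational_mul p)).congr fun σ σ' => by
      simp [Comp, and_assoc]
  refine (h.test_range isRational_flip_rel).congr fun σ σ' =>
    and_congr_left' ⟨?_, fun ⟨hσ1, hσ0⟩ => ?_⟩
  · rintro ⟨τ, ⟨hpos, hlt⟩, rfl⟩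
    refine ⟨by simp, ?_⟩
    rw [single_eq_same, Nat.dvd_add_left (dvd_mul_left ..)]
    exact Nat.not_dvd_of_pos_of_lt hpos hlt
  · refine ⟨single 0 (σ 0 / p) + single 1 (σ 0 % p), ?_, ?_⟩
    · simpa [Nat.pos_iff_ne_zero, Nat.mod_lt _ hp, Nat.dvd_iff_mod_eq_zero] using hσ0
    · ext i
      fin_cases i <;> simp [hσ1, mul_comm _ p, Nat.mod_add_div]

theorem exists_simulates_rel (a : RegOp ℕ) :
    ∃ Q, IsRational Rel Q ∧ Simulates (fun σ => single (0 : Fin 2) (godel σ)) Q (Rel a) := by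
  cases a with
  | inc r =>
    exact ⟨_, isRational_mul (Nat.nth Nat.Prime r), fun σ τ => by
      simp [RegOp.Rel, godel_add_single_one, eq_comm]⟩
  | dec r =>
    refine ⟨_, isRational_div (Nat.nth Nat.Prime r), fun σ τ => ⟨?_, ?_⟩⟩
    · rintro ⟨hτ, h⟩
      replace h : godel σ = τ 0 * Nat.nth Nat.Prime r := single_injective 0 h
      obtain ⟨σ', rfl⟩ := exists_eq_add_single
        ((nth_prime_dvd_godel_iff σ r).1 (h ▸ dvd_mul_left ..))
      rw [godel_add_single_one] at h
      refine ⟨σ', rfl, ?_⟩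
      ext i
      fin_cases i <;> simp [hτ, Nat.eq_of_mul_eq_mul_right (Nat.prime_nth_prime r).pos h]
    · rintro ⟨σ', rfl, rfl⟩
      exact ⟨by simp, by simp [godel_add_single_one]⟩
  | zero r =>
    refine ⟨_, isRational_test_not_dvd (Nat.prime_nth_prime r).pos, fun σ τ => ?_⟩
    simp [RegOp.Rel, nth_prime_dvd_godel_iff, and_assoc, eq_comm]

/-- Minsky's theorem: two registers suffice, if the input `n` is given as `2 ^ n`. -/
theorem exists_dfa_of_primrec₂ {p : ℕ → ℕ → ℕ} (hp : Primrec₂ p) :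
    ∃ (N : ℕ) (M : DFA (RegOp (Fin 2)) (Fin N)), ∀ n,
      langRel Rel M.accepts (single 0 (2 ^ n)) 0 ↔ ∃ k, p n k = 0 := by
  obtain ⟨P, hP, hPp⟩ := exists_isRational_of_primrec₂ hp
  obtain ⟨Q, hQ, hQP⟩ := hP.exists_simulates exists_simulates_rel
  obtain ⟨L, ⟨S, _, M, rfl⟩, hL⟩ := (hQ.comp (isRational_clear 0)).exists_isRegular
  refine ⟨_, DFA.reindex (Fintype.equivFin S) M, fun n => ?_⟩
  have hcode : single (0 : Fin 2) (2 ^ n) = single 0 (godel (single 0 n)) := by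
    rw [godel_single, Nat.nth_prime_zero_eq_two]
  have hQP (τ) : Q (single 0 (godel (single 0 n))) τ ↔
    ∃ σ, P (single 0 n) σ ∧ single 0 (godel σ) = τ := hQP _ _
  rw [DFA.accepts_reindex, hL, hcode, ← hPp]
  simp [Comp, hQP]

end TwoRegisters

namespace RegOp

variable {nX nE : ℕ}

/-- The condition on the energies, which hold the register contents, under which an instruction can
be executed. For a decrement it is empty, since energies remain nonnegative anyway. -/
def guard : RegOp (Fin nE) → SimpleConstraint nX nE
  | .inc _ => []
  | .dec _ => []
  | .zero r => [⟨.inr r, .le, 0⟩]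

/-- The energy update that executes an instruction. -/
def update : RegOp (Fin nE) → Fin nE → ℤ
  | .inc r => Pi.single r 1
  | .dec r => Pi.single r (-1)
  | .zero _ => 0

theorem rel_iff (a : RegOp (Fin nE)) (w : Fin nX → ℝ) (σ σ' : Fin nE →₀ ℕ) :
    a.Rel σ σ' ↔ a.guard.Sat w (fun i => (σ i : ℝ)) ∧
      ∀ i, (σ' i : ℝ) = (σ i : ℝ) + (a.update i : ℝ) := by
  have hcast (i : Fin nE) : (σ' i : ℝ) = (σ i : ℝ) + (a.update i : ℝ) ↔
      (σ' i : ℤ) = σ i + a.update i := by exact_mod_cast Iff.rfl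
  simp only [hcast]
  cases a with
  | zero r =>
    simp [RegOp.Rel, guard, SimpleConstraint.Sat, update, Finsupp.ext_iff, Cmp.Holds]
  | _ r =>
    simp only [RegOp.Rel, guard, SimpleConstraint.Sat, update, Finsupp.ext_iff,
      Finsupp.add_apply, Finsupp.single_apply, List.not_mem_nil, false_imp_iff, implies_true,
      true_and, Pi.single_apply]
    exact forall_congr' fun i => by split_ifs <;> grind

theorem exists_rel {a : RegOp (Fin nE)} {w : Fin nX → ℝ} {σ : Fin nE →₀ ℕ}
    (hg : a.guard.Sat w fun i => (σ i : ℝ)) (hnonneg : ∀ i, (0 : ℝ) ≤ σ i + a.update i) :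
    ∃ σ', a.Rel σ σ' ∧ ∀ i, (σ' i : ℝ) = σ i + a.update i := by
  have hnat (i : Fin nE) : ∃ k : ℕ, (k : ℤ) = σ i + a.update i :=
    (Int.eq_ofNat_of_zero_le (by exact_mod_cast hnonneg i)).imp fun _ => Eq.symm
  choose f hf using hnat
  have hσ' (i : Fin nE) :
      (Finsupp.equivFunOnFinite.symm f i : ℝ) = σ i + a.update i := by exact_mod_cast hf i
  exact ⟨_, (a.rel_iff w _ _).2 ⟨hg, hσ'⟩, hσ'⟩

end RegOp

section GuardedMultiEnergyTimedAutomata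

open Relation

namespace GuardedMETA

variable {nX nE : ℕ} {A : GuardedMETA nX nE}

/-- The last state of a path from `s`. -/
def pathEnd (s : Config nX nE) (ρ : List (RunStep nX nE)) : Config nX nE :=
  (s :: ρ.map RunStep.target).getLast (List.cons_ne_nil _ _)

theorem pathEnd_cons (s : Config nX nE) (x : RunStep nX nE) (ρ : List (RunStep nX nE)) :
    pathEnd s (x :: ρ) = pathEnd x.target ρ := by
  simp [pathEnd]

theorem Step.isState_right {s s' : Config nX nE} {d : ℝ} {e : Edge nX nE}
    (h : A.Step s d e s') : A.IsState s' :=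
  let ⟨_, _, _, _, hs', _⟩ := h
  hs'

theorem IsPath.exists_step_pathEnd {s : Config nX nE} {ρ : List (RunStep nX nE)}
    (h : A.IsPath s ρ) (hend : pathEnd s ρ ≠ s) : ∃ s' d e, A.Step s' d e (pathEnd s ρ) := by
  induction h with
  | nil _ => exact absurd rfl hend
  | @cons s d e s' ρ hstep _ ih =>
    rw [pathEnd_cons]
    by_cases hs' : pathEnd s' ρ = s'
    · exact ⟨s, d, e, hs'.symm ▸ hstep⟩
    · exact ih hs'

theorem DEO_of_duration_eq_one {ρ : List (RunStep nX nE)} (h : duration ρ = 1) :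
    A.DEO ρ = [(A.lastState ρ).energy] := by
  have hlevel : A.energyLevel ρ 1 = (A.lastState ρ).energy := by
    rw [energyLevel, Nat.findGreatest_eq (by simp [h]), List.take_length]
  simp [DEO, h, hlevel]

theorem deOpaque_iff_exists_isPublicRun {o : List (Fin nE → ℝ)} (hpriv : ∃ ρ, A.IsPrivateRun ρ)
    (hobs : ∀ ρ, A.IsRun ρ → A.IsFinal (A.lastState ρ).loc → A.DEO ρ = o) (δ : OpacityKind) :
    A.DEOpaque δ ↔ ∃ ρ, A.IsPublicRun ρ := by
  obtain ⟨ρ₀, h₀⟩ := hpriv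
  have heq {ρ ρ'} (h : A.IsPrivateRun ρ) (h' : A.IsPublicRun ρ') : A.DEO ρ = A.DEO ρ' :=
    (hobs ρ h.1 h.2.1).trans (hobs ρ' h'.1 h'.2.1).symm
  cases δ with
  | exist => exact ⟨fun ⟨_, ρ', _, h', _⟩ => ⟨ρ', h'⟩, fun ⟨ρ', h'⟩ => ⟨ρ₀, ρ', h₀, h', heq h₀ h'⟩⟩
  | weak =>
    exact ⟨fun h => (h ρ₀ h₀).imp fun _ => And.left, fun ⟨ρ', h'⟩ _ h => ⟨ρ', h', heq h h'⟩⟩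
  | full =>
    exact ⟨fun h => (h.1 ρ₀ h₀).imp fun _ => And.left,
      fun ⟨ρ', h'⟩ => ⟨fun _ h => ⟨ρ', h', heq h h'⟩, fun _ h' => ⟨ρ₀, h₀, heq h₀ h'⟩⟩⟩

/-- One step of a run, to a state that is not private. -/
def PublicStep (A : GuardedMETA nX nE) (s s' : Config nX nE) : Prop :=
  ¬ A.IsPriv s'.loc ∧ ∃ d e, A.Step s d e s'

theorem exists_isPath_iff_reflTransGen {s s' : Config nX nE} (hs : A.IsState s) :
    (∃ ρ, A.IsPath s ρ ∧ (∀ x ∈ ρ, ¬ A.IsPriv x.target.loc) ∧ pathEnd s ρ = s') ↔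
      ReflTransGen A.PublicStep s s' := by
  constructor
  · rintro ⟨ρ, h, hpub, rfl⟩
    induction h with
    | nil _ => exact .refl
    | cons hstep _ ih =>
      rw [List.forall_mem_cons] at hpub
      rw [pathEnd_cons]
      exact (ih hstep.isState_right hpub.2).head ⟨hpub.1, _, _, hstep⟩
  · intro h
    induction h using ReflTransGen.head_induction_on with
    | refl => exact ⟨[], .nil hs, by simp, rfl⟩
    | head hstep _ ih =>
      obtain ⟨hpub, d, e, hstep⟩ := hstep
      obtain ⟨ρ, hρ, hpubρ, hend⟩ := ih hstep.isState_right
      exact ⟨_, .cons hstep hρ, List.forall_mem_cons.2 ⟨hpub, hpubρ⟩, by rwa [pathEnd_cons]⟩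

theorem exists_isPublicRun_iff (hs : A.IsState A.initState) (hpub : ¬ A.IsPriv A.init) :
    (∃ ρ, A.IsPublicRun ρ) ↔
      ∃ s, ReflTransGen A.PublicStep A.initState s ∧ A.IsFinal s.loc := by
  have hstates (ρ : List (RunStep nX nE)) :
      (∀ s ∈ A.states ρ, ¬ A.IsPriv s.loc) ↔ ∀ x ∈ ρ, ¬ A.IsPriv x.target.loc := by
    simp only [states, List.forall_mem_cons, List.forall_mem_map]
    exact and_iff_right hpub
  simp only [← exists_isPath_iff_reflTransGen hs, IsPublicRun, hstates]
  exact ⟨fun ⟨ρ, h, hend, hρ⟩ => ⟨_, ⟨ρ, h, hρ, rfl⟩, hend⟩,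
    fun ⟨_, ⟨ρ, h, hρ, rfl⟩, hend⟩ => ⟨ρ, h, hend, hρ⟩⟩

/-- Automata without invariants, energy rates and resets: time only increases the clocks, and edges
only change the energies. -/
structure IsPlain (A : GuardedMETA nX nE) : Prop where
  inv_eq_nil : ∀ L ∈ A.locs, L.inv = []
  isDiscrete : A.IsDiscrete
  reset_eq_false : ∀ e ∈ A.edges, ∀ x, e.reset x = false

namespace IsPlain

theorem isState_iff (hA : A.IsPlain) {s : Config nX nE} :
    A.IsState s ↔ (∀ x, 0 ≤ s.clock x) ∧ (∀ η, 0 ≤ s.energy η) ∧ s.loc < A.locs.length := by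
  refine and_congr_right' (and_congr_right' ⟨?_, fun h => ⟨_, List.getElem?_eq_getElem h, ?_⟩⟩)
  · rintro ⟨L, hL, -⟩
    exact (List.getElem?_eq_some_iff.1 hL).1
  · simp [hA.inv_eq_nil _ (List.getElem_mem h), SimpleConstraint.Sat]

theorem delay_iff (hA : A.IsPlain) {s s' : Config nX nE} {d : ℝ} :
    A.Delay s d s' ↔
      A.IsState s ∧ 0 ≤ d ∧ s' = ⟨s.loc, fun x => s.clock x + d, s.energy⟩ := by
  have helapse {L : LocData nX nE} (hL : A.locs[s.loc]? = some L) (t : ℝ) :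
      s.elapse L.rate t = ⟨s.loc, fun x => s.clock x + t, s.energy⟩ := by
    simp [Config.elapse, hA.isDiscrete L (List.mem_of_getElem? hL)]
  constructor
  · rintro ⟨hd, L, hL, rfl, hstates⟩
    have hs := hstates 0 ⟨le_rfl, hd⟩
    rw [helapse hL] at hs ⊢
    exact ⟨by simpa using hs, hd, rfl⟩
  · rintro ⟨hs, hd, rfl⟩
    obtain ⟨L, hL, -⟩ := hs.2.2
    refine ⟨hd, L, hL, (helapse hL d).symm, fun t ht => ?_⟩
    rw [hA.isState_iff] at hs
    rw [helapse hL, hA.isState_iff]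
    exact ⟨fun x => add_nonneg (hs.1 x) ht.1, hs.2⟩

theorem step_iff (hA : A.IsPlain) {s s' : Config nX nE} {d : ℝ} {e : Edge nX nE} :
    A.Step s d e s' ↔ A.IsState s ∧ A.IsState s' ∧ 0 ≤ d ∧ e ∈ A.edges ∧ s.loc = e.src ∧
      e.guard.Sat (fun x => s.clock x + d) s.energy ∧
      s' = ⟨e.tgt, fun x => s.clock x + d, fun η => s.energy η + e.update η⟩ := by
  constructor
  · rintro ⟨_, hdelay, he, -, hs', hsrc, htgt, hg, hclock, henergy⟩
    obtain ⟨hs, hd, rfl⟩ := hA.delay_iff.1 hdelay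
    refine ⟨hs, hs', hd, he, hsrc, hg, Config.ext htgt (funext fun x => ?_) (funext henergy)⟩
    simpa [hA.reset_eq_false e he x] using hclock x
  · rintro ⟨hs, hs', hd, he, hsrc, hg, rfl⟩
    refine ⟨_, hA.delay_iff.2 ⟨hs, hd, rfl⟩, he, ?_, hs', hsrc, rfl, hg, fun x => ?_,
      fun _ => rfl⟩
    · rw [hA.isState_iff] at hs ⊢
      exact ⟨fun x => add_nonneg (hs.1 x) hd, hs.2⟩
    · simp [hA.reset_eq_false e he x]

theorem clock_pathEnd (hA : A.IsPlain) {s : Config nX nE} {ρ : List (RunStep nX nE)}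
    (h : A.IsPath s ρ) (x : Fin nX) : (pathEnd s ρ).clock x = s.clock x + duration ρ := by
  induction h with
  | nil _ => simp [pathEnd, duration]
  | cons hstep _ ih =>
    obtain ⟨-, -, -, -, -, -, rfl⟩ := hA.step_iff.1 hstep
    rw [pathEnd_cons, ih]
    simp [duration, add_assoc]

end IsPlain

/-- The constraint that all clocks are `1` and all energies are `0`. -/
def exitGuard (nX nE : ℕ) : SimpleConstraint nX nE :=
  (List.finRange nX).map (fun x => ⟨.inl x, .ge, 1⟩) ++
    (List.finRange nX).map (fun x => ⟨.inl x, .le, 1⟩) ++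
    (List.finRange nE).map fun η => ⟨.inr η, .le, 0⟩

theorem exitGuard_sat_iff {w : Fin nX → ℝ} {v : Fin nE → ℝ} (hv : ∀ η, 0 ≤ v η) :
    (exitGuard nX nE).Sat w v ↔ w = 1 ∧ v = 0 := by
  simp only [exitGuard, SimpleConstraint.Sat, List.mem_append, List.mem_map, List.mem_finRange,
    true_and, or_imp, forall_and, forall_exists_index, forall_apply_eq_imp_iff, Cmp.Holds,
    Sum.elim_inl, Sum.elim_inr, Int.cast_one, Int.cast_zero, le_antisymm_iff, Pi.le_def,
    Pi.one_apply, Pi.zero_apply, hv, implies_true, and_true]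
  exact and_congr_left' and_comm

section MachineMETA

variable {N : ℕ} (M : DFA (RegOp (Fin nE)) (Fin N)) (τ : Fin nE →₀ ℕ)

/-- An edge with silent action and without resets. -/
def plainEdge (src : ℕ) (guard : SimpleConstraint nX nE) (update : Fin nE → ℤ) (tgt : ℕ) :
    Edge nX nE :=
  ⟨src, guard, none, fun _ => false, update, tgt⟩

/-- A location without invariant and with energy rates `0`. -/
def plainLoc (isPriv isFinal : Bool) : LocData nX nE := ⟨isPriv, isFinal, [], [], fun _ => 0⟩

/-- The locations of `machineMETA`: the initial location `0`, the private location `1`, the final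
location `2`, and the states of the machine from `3` on. -/
def machineLocs (nX nE N : ℕ) : List (LocData nX nE) :=
  plainLoc false false :: plainLoc true false :: plainLoc false true ::
    List.replicate N (plainLoc false false)

/-- The edges of `machineMETA` that do not depend on the initial register contents: the private
branch, the instructions of the machine, and its acceptance. -/
noncomputable def machineEdges (nX : ℕ) : List (Edge nX nE) :=
  plainEdge 0 [] 0 1 :: plainEdge 1 (exitGuard nX nE) 0 2 ::
    (((Set.toFinite (Set.univ : Set (Fin N × RegOp (Fin nE)))).toFinset.toList.map fun q =>
        plainEdge (3 + q.1) q.2.guard q.2.update (3 + M.step q.1 q.2)) ++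
      (Set.toFinite M.accept).toFinset.toList.map fun q =>
        plainEdge (3 + q) (exitGuard nX nE) 0 2)

/-- The guarded META that reaches the final location at time `1` with energies `0`, either through
the private location, or by running the register machine `M` from the register contents `τ`. -/
noncomputable def machineMETA (nX : ℕ) : GuardedMETA nX nE where
  numActions := 0
  numProps := 0
  locs := machineLocs nX nE N
  init := 0
  edges := plainEdge 0 [] (fun i => (τ i : ℤ)) (3 + M.start) :: machineEdges M nX

theorem mem_edges_machineMETA {e : Edge nX nE} : e ∈ (machineMETA M τ nX).edges ↔
    e = plainEdge 0 [] (fun i => (τ i : ℤ)) (3 + M.start) ∨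
    e = plainEdge 0 [] 0 1 ∨ e = plainEdge 1 (exitGuard nX nE) 0 2 ∨
    (∃ (q : Fin N) (a : RegOp (Fin nE)),
      e = plainEdge (3 + q) a.guard a.update (3 + M.step q a)) ∨
    ∃ q ∈ M.accept, e = plainEdge (3 + q) (exitGuard nX nE) 0 2 := by
  simp [machineMETA, machineEdges, eq_comm]

theorem length_locs_machineMETA : (machineMETA M τ nX).locs.length = 3 + N := by
  simp [machineMETA, machineLocs, add_comm 3 N]

theorem getElem?_machineLocs {l : ℕ} {L : LocData nX nE} : (machineLocs nX nE N)[l]? = some L ↔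
    l < 3 + N ∧ L = plainLoc (decide (l = 1)) (decide (l = 2)) := by
  rcases l with _ | _ | _ | l
  · simp [machineLocs, eq_comm]
  · simp [machineLocs, eq_comm]; omega
  · simp [machineLocs, eq_comm]; omega
  · simp [machineLocs, List.getElem?_replicate, eq_comm, add_comm 3 N]

theorem mem_locs_machineMETA {L : LocData nX nE} (hL : L ∈ (machineMETA M τ nX).locs) :
    ∃ b b', L = plainLoc b b' :=
  let ⟨_, hl⟩ := List.mem_iff_getElem?.1 hL
  ⟨_, _, (getElem?_machineLocs.1 hl).2⟩

theorem isPriv_machineMETA {l : ℕ} : (machineMETA M τ nX).IsPriv l ↔ l = 1 := by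
  simp only [IsPriv, machineMETA, getElem?_machineLocs, and_assoc, exists_and_left,
    exists_eq_left, plainLoc, decide_eq_true_eq, and_iff_right_iff_imp]
  omega

theorem isFinal_machineMETA {l : ℕ} : (machineMETA M τ nX).IsFinal l ↔ l = 2 := by
  simp only [IsFinal, machineMETA, getElem?_machineLocs, and_assoc, exists_and_left,
    exists_eq_left, plainLoc, decide_eq_true_eq, and_iff_right_iff_imp]
  omega

theorem isPlain_machineMETA : (machineMETA M τ nX).IsPlain where
  inv_eq_nil L hL := by
    obtain ⟨b, b', rfl⟩ := mem_locs_machineMETA M τ hL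
    rfl
  isDiscrete L hL η := by
    obtain ⟨b, b', rfl⟩ := mem_locs_machineMETA M τ hL
    rfl
  reset_eq_false e he x := by
    obtain rfl | rfl | rfl | ⟨q, a, rfl⟩ | ⟨q, -, rfl⟩ := (mem_edges_machineMETA M τ).1 he <;> rfl

theorem src_tgt_machineMETA {e : Edge nX nE} (he : e ∈ (machineMETA M τ nX).edges) :
    e.src < 3 + N ∧ e.tgt < 3 + N ∧ e.src ≠ 2 ∧ e.act = none := by
  obtain rfl | rfl | rfl | ⟨q, a, rfl⟩ | ⟨q, -, rfl⟩ := (mem_edges_machineMETA M τ).1 he <;>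
    refine ⟨?_, ?_, ?_, rfl⟩ <;> simp only [plainEdge] <;> omega

theorem wellFormed_machineMETA : (machineMETA M τ nX).WellFormed where
  init_lt := by simp [machineMETA, machineLocs]
  label_lt L hL := by
    obtain ⟨b, b', rfl⟩ := mem_locs_machineMETA M τ hL
    simp [plainLoc]
  src_lt e he := length_locs_machineMETA M τ ▸ (src_tgt_machineMETA M τ he).1
  tgt_lt e he := length_locs_machineMETA M τ ▸ (src_tgt_machineMETA M τ he).2.1
  act_lt e he := by simp [(src_tgt_machineMETA M τ he).2.2.2]
  exists_priv := ⟨1, (isPriv_machineMETA M τ).2 rfl⟩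
  exists_final := ⟨2, (isFinal_machineMETA M τ).2 rfl⟩
  not_priv_of_final l := by
    rw [isFinal_machineMETA, isPriv_machineMETA]
    omega
  final_no_edge e he := by
    rw [isFinal_machineMETA]
    exact (src_tgt_machineMETA M τ he).2.2.1
  init_inv L hL := by
    simp [(isPlain_machineMETA M τ).inv_eq_nil L (List.mem_of_getElem? hL), SimpleConstraint.Sat]

/-- The state with all clocks equal to `t` and the natural numbers `σ` as energies. -/
def natConfig (nX : ℕ) (l : ℕ) (t : ℝ) (σ : Fin nE →₀ ℕ) : Config nX nE :=
  ⟨l, fun _ => t, fun i => σ i⟩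

theorem isState_natConfig {l : ℕ} {t : ℝ} (hl : l < 3 + N) (ht : 0 ≤ t) (σ : Fin nE →₀ ℕ) :
    (machineMETA M τ nX).IsState (natConfig nX l t σ) := by
  rw [(isPlain_machineMETA M τ).isState_iff, length_locs_machineMETA]
  exact ⟨fun _ => ht, fun _ => Nat.cast_nonneg _, hl⟩

theorem initState_machineMETA : (machineMETA M τ nX).initState = natConfig nX 0 0 0 := by
  simp [initState, machineMETA, natConfig]

theorem isState_initState_machineMETA :
    (machineMETA M τ nX).IsState (machineMETA M τ nX).initState := by
  rw [initState_machineMETA]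
  exact isState_natConfig M τ (by omega) le_rfl 0

theorem step_natConfig {l l' : ℕ} {t d : ℝ} {g : SimpleConstraint nX nE} {u : Fin nE → ℤ}
    {σ σ' : Fin nE →₀ ℕ} (he : plainEdge l g u l' ∈ (machineMETA M τ nX).edges) (ht : 0 ≤ t)
    (hd : 0 ≤ d) (hg : g.Sat (fun _ => t + d) fun i => (σ i : ℝ))
    (hσ' : ∀ i, (σ' i : ℝ) = σ i + u i) :
    (machineMETA M τ nX).Step (natConfig nX l t σ) d (plainEdge l g u l')
      (natConfig nX l' (t + d) σ') := by
  obtain ⟨hl, hl', -⟩ := src_tgt_machineMETA M τ he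
  refine (isPlain_machineMETA M τ).step_iff.2 ⟨isState_natConfig M τ hl ht σ,
    isState_natConfig M τ hl' (add_nonneg ht hd) σ', hd, he, rfl, hg, ?_⟩
  exact Config.ext rfl rfl (funext hσ')

theorem step_exit {l : ℕ} (he : plainEdge l (exitGuard nX nE) 0 2 ∈ (machineMETA M τ nX).edges) :
    (machineMETA M τ nX).Step (natConfig nX l 0 0) 1 (plainEdge l (exitGuard nX nE) 0 2)
      (natConfig nX 2 (0 + 1) 0) :=
  step_natConfig M τ he le_rfl zero_le_one
    ((exitGuard_sat_iff (by simp)).2 ⟨by simp [funext_iff], by simp [funext_iff]⟩) (by simp)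

theorem exists_isPrivateRun_machineMETA : ∃ ρ, (machineMETA M τ nX).IsPrivateRun ρ := by
  have henter : (machineMETA M τ nX).Step (natConfig nX 0 0 0) 0 (plainEdge 0 [] 0 1)
      (natConfig nX 1 0 0) := by
    simpa using step_natConfig (σ := 0) (σ' := 0) M τ
      ((mem_edges_machineMETA M τ).2 (.inr (.inl rfl))) le_rfl le_rfl
      (by simp [SimpleConstraint.Sat]) (by simp)
  have hexit := step_exit M τ (nX := nX) (l := 1)
    ((mem_edges_machineMETA M τ).2 (.inr (.inr (.inl rfl))))
  refine ⟨[⟨0, plainEdge 0 [] 0 1, natConfig nX 1 0 0⟩,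
      ⟨1, plainEdge 1 (exitGuard nX nE) 0 2, natConfig nX 2 (0 + 1) 0⟩], ?_,
    (isFinal_machineMETA M τ).2 ?_, natConfig nX 1 0 0, ?_, (isPriv_machineMETA M τ).2 rfl⟩
  · rw [IsRun, initState_machineMETA]
    exact .cons henter (.cons hexit (.nil hexit.isState_right))
  · rfl
  · simp [states]

theorem DEO_machineMETA [NeZero nX] {ρ : List (RunStep nX nE)}
    (h : (machineMETA M τ nX).IsRun ρ)
    (hend : (machineMETA M τ nX).IsFinal ((machineMETA M τ nX).lastState ρ).loc) :
    (machineMETA M τ nX).DEO ρ = [0] := by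
  have hA := isPlain_machineMETA M τ (nX := nX)
  rw [isFinal_machineMETA] at hend
  have hne : (machineMETA M τ nX).lastState ρ ≠ (machineMETA M τ nX).initState :=
    fun heq => by simp [heq, initState_machineMETA, natConfig] at hend
  obtain ⟨s, d, e, hstep⟩ := h.exists_step_pathEnd hne
  obtain ⟨hs, -, -, he, -, hg, hs'⟩ := hA.step_iff.1 hstep
  have hexit : e.guard = exitGuard nX nE ∧ e.update = 0 := by
    have htgt : e.tgt = 2 := (congrArg Config.loc hs').symm.trans hend
    obtain rfl | rfl | rfl | ⟨q, a, rfl⟩ | ⟨q, -, rfl⟩ := (mem_edges_machineMETA M τ).1 he <;>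
      simp only [plainEdge] at htgt <;> first | exact ⟨rfl, rfl⟩ | omega
  rw [hexit.1, exitGuard_sat_iff hs.2.1] at hg
  have hclock := hA.clock_pathEnd h 0
  rw [hs', initState_machineMETA] at hclock
  have hdur : duration ρ = 1 := by simpa [natConfig, congrFun hg.1 0] using hclock.symm
  rw [DEO_of_duration_eq_one hdur]
  change [(pathEnd _ ρ).energy] = _
  simp [hs', hexit.2, hg.2, ← Pi.zero_def]

theorem publicStep_of_step {s s' : Config nX nE} {d : ℝ} {e : Edge nX nE} (hs' : s'.loc ≠ 1)
    (h : (machineMETA M τ nX).Step s d e s') : (machineMETA M τ nX).PublicStep s s' :=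
  ⟨by rwa [isPriv_machineMETA], d, e, h⟩

theorem reflTransGen_of_wordRel {w : List (RegOp (Fin nE))} {q : Fin N} {σ σ' : Fin nE →₀ ℕ}
    (h : wordRel RegOp.Rel w σ σ') :
    ReflTransGen (machineMETA M τ nX).PublicStep (natConfig nX (3 + q) 0 σ)
      (natConfig nX (3 + M.evalFrom q w) 0 σ') := by
  induction w generalizing q σ with
  | nil =>
    obtain rfl : σ = σ' := h
    rfl
  | cons a w ih =>
    obtain ⟨ρ, ha, hw⟩ := h
    obtain ⟨hg, hu⟩ := (a.rel_iff (fun _ => 0 + 0) σ ρ).1 ha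
    have hstep := step_natConfig M τ (nX := nX)
      ((mem_edges_machineMETA M τ).2 (.inr (.inr (.inr (.inl ⟨q, a, rfl⟩))))) le_rfl le_rfl hg hu
    rw [add_zero] at hstep
    exact .head (publicStep_of_step M τ (by simp only [natConfig]; omega) hstep) (ih hw)

theorem exists_reflTransGen_of_langRel (h : langRel RegOp.Rel M.accepts τ 0) :
    ∃ s, ReflTransGen (machineMETA M τ nX).PublicStep (machineMETA M τ nX).initState s ∧
      s.loc = 2 := by
  obtain ⟨w, hw, hrel⟩ := h
  have henter : (machineMETA M τ nX).Step (natConfig nX 0 0 0) 0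
      (plainEdge 0 [] (fun i => (τ i : ℤ)) (3 + M.start)) (natConfig nX (3 + M.start) 0 τ) := by
    simpa using step_natConfig (σ := 0) (σ' := τ) M τ
      ((mem_edges_machineMETA M τ).2 (.inl rfl)) le_rfl le_rfl (by simp [SimpleConstraint.Sat])
      (by simp)
  have hexit := step_exit M τ (nX := nX) (l := 3 + M.eval w)
    ((mem_edges_machineMETA M τ).2 (.inr (.inr (.inr (.inr ⟨_, hw, rfl⟩)))))
  rw [initState_machineMETA]
  refine ⟨_, .head (publicStep_of_step M τ ?_ henter)
    (.tail (reflTransGen_of_wordRel M τ hrel) (publicStep_of_step M τ ?_ hexit)), rfl⟩ <;>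
  simp only [natConfig] <;> omega

theorem loc_energy_of_reflTransGen {s : Config nX nE}
    (h : ReflTransGen (machineMETA M τ nX).PublicStep (machineMETA M τ nX).initState s) :
    (s.loc = 0 ∧ s.energy = 0) ∨
      (∃ w σ, wordRel RegOp.Rel w τ σ ∧ s.loc = 3 + M.eval w ∧ ∀ i, s.energy i = σ i) ∨
      (s.loc = 2 ∧ langRel RegOp.Rel M.accepts τ 0) := by
  induction h with
  | refl => exact .inl ⟨rfl, rfl⟩
  | @tail s s' _ hstep ih =>
    obtain ⟨hpub, d, e, hstep⟩ := hstep
    obtain ⟨hs, hs', -, he, hsrc, hg, rfl⟩ := (isPlain_machineMETA M τ).step_iff.1 hstep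
    rw [isPriv_machineMETA] at hpub
    obtain rfl | rfl | rfl | ⟨q, a, rfl⟩ | ⟨q, hq, rfl⟩ := (mem_edges_machineMETA M τ).1 he <;>
      simp only [plainEdge] at hsrc hpub hg hs' ⊢
    · obtain ⟨-, henergy⟩ | ⟨w, σ, -, hloc, -⟩ | ⟨hloc, -⟩ := ih
      · exact .inr (.inl ⟨[], τ, rfl, rfl, by simp [henergy]⟩)
      all_goals omega
    · exact absurd trivial hpub
    · obtain ⟨hloc, -⟩ | ⟨w, σ, -, hloc, -⟩ | ⟨hloc, -⟩ := ih <;> omega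
    · obtain ⟨hloc, -⟩ | ⟨w, σ, hw, hloc, henergy⟩ | ⟨hloc, -⟩ := ih
      · omega
      · obtain rfl : q = M.eval w := by omega
        simp only [funext henergy] at hg hs' ⊢
        obtain ⟨σ', ha, hσ'⟩ := RegOp.exists_rel hg hs'.2.1
        refine .inr (.inl ⟨w ++ [a], σ', ?_, by simp, fun i => (hσ' i).symm⟩)
        rw [wordRel_append]
        exact ⟨σ, hw, σ', ha, rfl⟩
      · omega
    · obtain ⟨hloc, -⟩ | ⟨w, σ, hw, hloc, henergy⟩ | ⟨hloc, -⟩ := ih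
      · omega
      · obtain rfl : q = M.eval w := by omega
        have hzero := ((exitGuard_sat_iff hs.2.1).1 hg).2
        obtain rfl : σ = 0 := Finsupp.ext fun i => by
          simpa [hzero] using (henergy i).symm
        exact .inr (.inr ⟨trivial, w, hq, hw⟩)
      · omega

theorem deOpaque_machineMETA_iff [NeZero nX] (δ : OpacityKind) :
    (machineMETA M τ nX).DEOpaque δ ↔ langRel RegOp.Rel M.accepts τ 0 := by
  rw [deOpaque_iff_exists_isPublicRun (exists_isPrivateRun_machineMETA M τ)
    (fun _ => DEO_machineMETA M τ), exists_isPublicRun_iff (isState_initState_machineMETA M τ)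
    ((isPriv_machineMETA M τ).not.2 zero_ne_one)]
  simp only [isFinal_machineMETA]
  refine ⟨fun ⟨s, hs, hfinal⟩ => ?_, exists_reflTransGen_of_langRel M τ⟩
  obtain ⟨hloc, -⟩ | ⟨w, σ, -, hloc, -⟩ | ⟨-, h⟩ := loc_energy_of_reflTransGen M τ hs
  · omega
  · omega
  · exact h

end MachineMETA

end GuardedMETA

end GuardedMultiEnergyTimedAutomata

section Undecidability

open GuardedMETA

theorem primrec_int_natCast : Primrec fun n : ℕ => (n : ℤ) :=
  Primrec.encode_iff.1 (Primrec.nat_double.of_eq fun _ => rfl)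

theorem primrec_const_pow (b : ℕ) : Primrec fun n : ℕ => b ^ n :=
  (Primrec.nat_rec₁ 1 (Primrec.nat_mul.comp Primrec.snd (Primrec.const b)).to₂).of_eq fun n => by
    induction n with
    | zero => rfl
    | succ n ih => rw [pow_succ, ← ih]

theorem primrec_machineMETA {nX nE N : ℕ} (M : DFA (RegOp (Fin nE)) (Fin N)) (r : Fin nE) :
    Primrec fun c : ℕ => machineMETA M (Finsupp.single r c) nX := by
  have hupdate : Primrec fun (c : ℕ) (i : Fin nE) => (Finsupp.single r c i : ℤ) := by
    refine Primrec.fin_curry.2 ((primrec_int_natCast.comp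
      (Primrec.ite (Primrec.eq.comp (Primrec.const r) Primrec.snd) Primrec.fst
        (Primrec.const 0))).of_eq fun p => ?_)
    exact congrArg _ Finsupp.single_apply.symm
  have hedge : Primrec fun c : ℕ => (plainEdge 0 [] (fun i => (Finsupp.single r c i : ℤ))
      (3 + M.start) : Edge nX nE) :=
    (Primrec.of_equiv_iff (Edge.equivProd nX nE)).1
      ((Primrec.const 0).pair ((Primrec.const []).pair ((Primrec.const none).pair
        ((Primrec.const fun _ => false).pair (hupdate.pair (Primrec.const _))))))
  exact (Primrec.of_equiv_iff (GuardedMETA.equivProd nX nE)).1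
    ((Primrec.const 0).pair ((Primrec.const 0).pair ((Primrec.const _).pair
      ((Primrec.const 0).pair (Primrec.list_cons.comp hedge (Primrec.const _))))))

theorem DecidableOn.computablePred {α : Type} {β : Type*} [Primcodable α] [Primcodable β]
    {C : Set α} {P : α → Prop} (h : DecidableOn C P) {g : β → α} (hg : Computable g)
    (hC : ∀ b, g b ∈ C) : ComputablePred fun b => P (g b) := by
  classical
  obtain ⟨f, hf, hfP⟩ := h
  refine ⟨inferInstance, (hf.comp hg).of_eq fun b => ?_⟩
  obtain ⟨r, hr, hrP⟩ := hfP (g b) (hC b)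
  rw [Part.eq_some_iff.2 hr]
  cases r <;> simp_all

open Nat.Partrec in
theorem exists_primrec₂_of_rePred {α : Type*} [Primcodable α] {P : α → Prop} (hP : REPred P) :
    ∃ f : ℕ → ℕ → ℕ, Primrec₂ f ∧ ∀ a, (∃ k, f (Encodable.encode a) k = 0) ↔ P a := by
  obtain ⟨c, hc⟩ := Code.exists_code.1 hP
  refine ⟨fun n k => if (c.evaln k n).isSome then 0 else 1,
    Primrec.ite (Primrec.eq.comp (Primrec.option_isSome.comp (Code.primrec_evaln.comp
      ((Primrec.snd.pair (Primrec.const c)).pair Primrec.fst))) (Primrec.const true))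
      (Primrec.const 0) (Primrec.const 1), fun a => ?_⟩
  have hdom : P a ↔ (c.eval (Encodable.encode a)).Dom := by simp [hc, Part.assert]
  simp only [hdom, Part.dom_iff_mem, Code.evaln_complete, Option.mem_def]
  rw [exists_comm]
  refine exists_congr fun k => ?_
  rw [← Option.isSome_iff_exists]
  split_ifs with h <;> simp [h]

theorem exists_computable_deOpaque_iff {α : Type*} [Primcodable α] {P : α → Prop}
    (hP : REPred P) : ∃ g : α → GuardedMETA 1 2, Computable g ∧
      ∀ a, (g a).WellFormed ∧ (g a).IsDiscrete ∧ ∀ δ, (g a).DEOpaque δ ↔ P a := by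
  obtain ⟨f, hf, hfP⟩ := exists_primrec₂_of_rePred hP
  obtain ⟨N, M, hM⟩ := exists_dfa_of_primrec₂ hf
  refine ⟨fun a => machineMETA M (Finsupp.single 0 (2 ^ Encodable.encode a)) 1,
    ((primrec_machineMETA M 0).comp ((primrec_const_pow 2).comp Primrec.encode)).to_comp,
    fun a => ⟨wellFormed_machineMETA M _, (isPlain_machineMETA M _).isDiscrete, fun δ => ?_⟩⟩
  rw [deOpaque_machineMETA_iff, hM, hfP]

end Undecidability

theorem mainTheorem7 (δ : OpacityKind) :
    ¬ DecidableOn {A : GuardedMETA 1 2 | A.WellFormed ∧ A.IsDiscrete}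
      (fun A => A.DEOpaque δ) := by
  intro h
  obtain ⟨g, hg, hgP⟩ := exists_computable_deOpaque_iff (ComputablePred.halting_problem_re 0)
  have hdec : ComputablePred fun c => (g c).DEOpaque δ :=
    h.computablePred hg fun c => ⟨(hgP c).1, (hgP c).2.1⟩
  exact ComputablePred.halting_problem 0 (hdec.of_eq fun c => (hgP c).2.2 δ)
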